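/- Let $\mathbb Z_2$ be the ring of 2-adic integers with absolute value $|\cdot|_2$ and normalized Haar measure $\mu_2$ ($\mu_2(a+2^k\mathbb Z_2)=2^{-k}$). A map $f\colon\mathbb Z_2\to\mathbb Z_2$ is called a T-function if for every $j\ge 0$ the $j$-th binary digit of $f(x)$ is a Boolean function of the binary digits of $x$ with indices $0,\dots,j$. It is called ergodic if it is measurable, preserves $\mu_2$, and every measurable $S\subseteq\mathbb Z_2$ with $f^{-1}(S)=S$ has $\mu_2(S)\in\{0,1\}$. Put $\lfloor\log_2 0\rfloor=0$, and for $m\in\{0,1,2,\dots\}$ and $x\in\mathbb Z_2$ let $\chi(m,x)=1$ if $|x-m|_2\le 2^{-\lfloor\log_2 m\rfloor-1}$ and $\chi(m,x)=0$ otherwise. Theorem. Let $f\colon\mathbb Z_2\to\mathbb Z_2$ be a T-function. Then $f$ is ergodic if and only if for every $k\ge 1$ the map $f\bmod 2^k$ induced by $f$ on $\mathbb Z/2^k\mathbb Z$ is transitive, i.e. a permutation with a single cycle. Moreover, $f$ is ergodic if and only if there are $b_0,b_1,b_2,\ldots\in\mathbb Z_2$ such that for all $x\in\mathbb Z_2$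 $$f(x)=b_0\,\chi(0,x)+b_1\,\chi(1,x)+\sum_{m=2}^{\infty}2^{\lfloor\log_2 m\rfloor}\,b_m\,\chi(m,x)$$ (the series being convergent in $\mathbb Z_2$) and the following conditions hold simultaneously: 1. $b_0\equiv 1\pmod 2$; 2. $b_0+b_1\equiv 3\pmod 4$; 3. $|b_m|_2=1$ for all $m\ge 2$; 4. $b_2+b_3\equiv 2\pmod 4$; 5. $\sum_{m=2^{n-1}}^{2^n-1}b_m\equiv 0\pmod 4$ for all $n\ge 3$. -/

import Mathlib

open MeasureTheory

/-- The Borel σ-algebra on the ring `ℤ_[2]` of 2-adic integers. -/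
noncomputable instance instMeasurableSpaceZ2 : MeasurableSpace ℤ_[2] := borel ℤ_[2]

instance instBorelSpaceZ2 : BorelSpace ℤ_[2] := ⟨rfl⟩

/-- The normalized Haar measure on `ℤ_[2]`: the additive Haar measure giving the whole space
mass `1`. -/
noncomputable def haarZ2 : Measure ℤ_[2] := Measure.addHaarMeasure ⊤

/-- The `j`-th binary digit of a 2-adic integer `x`, read off from the least nonnegative
residue of `x` modulo `2 ^ (j + 1)`. -/
noncomputable def binDigit (j : ℕ) (x : ℤ_[2]) : Bool :=
  (PadicInt.toZModPow (j + 1) x).val.testBit j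

/-- A (univariate) T-function: the `j`-th binary digit of `f x` is a Boolean function `ψ j`
of the binary digits of `x` with indices `0, …, j`. -/
def IsTFunction (f : ℤ_[2] → ℤ_[2]) : Prop :=
  ∃ ψ : (j : ℕ) → (Fin (j + 1) → Bool) → Bool,
    ∀ (j : ℕ) (x : ℤ_[2]), binDigit j (f x) = ψ j (fun i => binDigit i x)

/-- The transformation `f mod 2 ^ k` of the residue ring modulo `2 ^ k`: each residue is
represented by an integer in `{0, …, 2 ^ k - 1}`, to which `f` is applied, and the value is reduced
modulo `2 ^ k`. -/
noncomputable def redMod (f : ℤ_[2] → ℤ_[2]) (k : ℕ) : ZMod (2 ^ k) → ZMod (2 ^ k) :=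
  fun r => PadicInt.toZModPow k (f (r.val : ℤ_[2]))

/-- A self-map is transitive if it is a permutation with a single cycle. -/
def IsSingleCycle {α : Type*} (g : α → α) : Prop :=
  Function.Bijective g ∧ ∀ a b : α, ∃ i : ℕ, g^[i] a = b

open scoped Classical in
/-- The van der Put function `χ(m, x)`: the indicator function of the ball of radius `2 ^ (-n)`
centred at `m`, where `n = ⌊log₂ m⌋ + 1` is the number of binary digits of `m`
(with `n = 1` for `m = 0`, in accordance with `Nat.log 2 0 = 0`). -/
noncomputable def vdpChi (m : ℕ) (x : ℤ_[2]) : ℤ_[2] :=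
  if ‖x - (m : ℤ_[2])‖ ≤ (2 : ℝ) ^ (-((Nat.log 2 m + 1 : ℕ) : ℤ)) then 1 else 0

/-!
A T-function is the same as a map compatible with all congruences modulo `2 ^ k`; only the direction
used below, `IsTFunction.isCompatible`, is proved. Such an `f` induces maps modulo every `2 ^ k`,
and residue classes modulo `2 ^ k` form a π-system generating the Borel σ-algebra, each of Haar
measure `2 ^ (-k)`.

*Ergodicity and transitivity.* If `f` is ergodic, every residue class has a preimage of positive
measure, so `f` is a permutation modulo `2 ^ k`, and the union of the residue classes on one cycle is
an invariant set of positive measure, hence everything. Conversely, if `f` is transitive modulo all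
`2 ^ k`, it permutes the residue classes and so preserves the measure, and an invariant set `s` has
the same measure in each residue class of a given level. Thus `s` is independent of all residue
classes, hence of all measurable sets, in particular of itself, and `μ s = μ s ^ 2`
(`IsCompatible.ergodic_iff`).

*Lifting cycles.* Suppose that `f` is transitive modulo `2 ^ k`. It is a permutation modulo
`2 ^ (k + 1)` exactly when `f (2 ^ k + r) ≡ f r + 2 ^ k` for all `r < 2 ^ k`, and then
`f x - x` modulo `2 ^ (k + 1)` depends only on `x` modulo `2 ^ k`. Summing the increments
`f x - x` along the first `2 ^ k` points of the orbit of `0` gives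
`f^[2 ^ k] 0 ≡ ∑ r < 2 ^ k, (f r - r)`, and `f` is transitive modulo `2 ^ (k + 1)` exactly when this
is `2 ^ k` rather than `0` (`IsCompatible.isSingleCycle_succ_iff`).

*Van der Put coefficients.* The series represents `f` exactly when `b 0 = f 0`, `b 1 = f 1` and
`2 ^ k * b (2 ^ k + r) = f (2 ^ k + r) - f r` for `r < 2 ^ k`, `1 ≤ k` (`IsVdpCoeff.hasSum`,
`isVdpCoeff_of_hasSum`). In these terms the first condition of the lifting criterion says that
`b (2 ^ k + r)` is odd. Writing `D k` for the sum of the increments, one finds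
`D (k + 1) - 2 ^ (k + 1) = 2 * (D k - 2 ^ k) + 2 ^ k * (∑ r < 2 ^ k, b (2 ^ k + r) - 2 ^ k)`, so
that, given the condition at level `k`, the one at level `k + 1` says
`∑ r < 2 ^ k, b (2 ^ k + r) ≡ 2 ^ k` modulo `4`, where `2 ^ k ≡ 0` unless `k = 1`
(`IsVdpCoeff.dvd_incrementSum_succ_iff`).
-/

/-! ### Residues modulo powers of two -/

theorem two_pow_dvd_iff_norm_le {k : ℕ} {x : ℤ_[2]} :
    (2 : ℤ_[2]) ^ k ∣ x ↔ ‖x‖ ≤ (2 : ℝ) ^ (-(k : ℤ)) := by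
  have h := PadicInt.norm_le_pow_iff_mem_span_pow (p := 2) x k
  rw [Ideal.mem_span_singleton] at h
  exact_mod_cast h.symm

theorem toZModPow_eq_zero_iff {k : ℕ} {x : ℤ_[2]} :
    PadicInt.toZModPow k x = 0 ↔ (2 : ℤ_[2]) ^ k ∣ x := by
  rw [← RingHom.mem_ker, PadicInt.ker_toZModPow, Ideal.mem_span_singleton]
  norm_cast

theorem toZModPow_eq_iff {k : ℕ} {x y : ℤ_[2]} :
    PadicInt.toZModPow k x = PadicInt.toZModPow k y ↔ (2 : ℤ_[2]) ^ k ∣ x - y := by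
  rw [← toZModPow_eq_zero_iff, map_sub, sub_eq_zero]

theorem toZModPow_val (k : ℕ) (r : ZMod (2 ^ k)) :
    PadicInt.toZModPow k (r.val : ℤ_[2]) = r := by
  rw [map_natCast, ZMod.natCast_zmod_val]

theorem two_pow_dvd_sub_val (k : ℕ) (x : ℤ_[2]) :
    (2 : ℤ_[2]) ^ k ∣ x - ((PadicInt.toZModPow k x).val : ℤ_[2]) := by
  rw [← toZModPow_eq_iff, toZModPow_val]

theorem val_toZModPow_lt (k : ℕ) (x : ℤ_[2]) : (PadicInt.toZModPow k x).val < 2 ^ k :=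
  ZMod.val_lt _

/-- Two natural numbers below `2 ^ k` that agree modulo `2 ^ k` in `ℤ_[2]` are equal. -/
theorem eq_of_lt_of_two_pow_dvd {k r s : ℕ} (hr : r < 2 ^ k) (hs : s < 2 ^ k)
    (h : (2 : ℤ_[2]) ^ k ∣ (r : ℤ_[2]) - s) : r = s := by
  rw [← toZModPow_eq_iff, map_natCast, map_natCast, ZMod.natCast_eq_natCast_iff] at h
  exact Nat.ModEq.eq_of_lt_of_lt h hr hs

theorem val_toZModPow_of_le {j k : ℕ} (h : j ≤ k) (x : ℤ_[2]) :
    (PadicInt.toZModPow j x).val = (PadicInt.toZModPow k x).val % 2 ^ j := by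
  rw [← PadicInt.cast_toZModPow j k h x, ZMod.cast_eq_val, ZMod.val_natCast]

/-! ### T-functions as compatible maps -/

/-- A self-map of `ℤ_[2]` is compatible if it respects every congruence modulo a power of two,
that is, if it is `1`-Lipschitz for the `2`-adic absolute value. -/
def IsCompatible (f : ℤ_[2] → ℤ_[2]) : Prop :=
  ∀ (k : ℕ) (x y : ℤ_[2]), (2 : ℤ_[2]) ^ k ∣ x - y → (2 : ℤ_[2]) ^ k ∣ f x - f y

theorem binDigit_eq_testBit {j k : ℕ} (h : j < k) (x : ℤ_[2]) :
    binDigit j x = (PadicInt.toZModPow k x).val.testBit j := by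
  rw [binDigit, val_toZModPow_of_le (Nat.succ_le_of_lt h) x, Nat.testBit_mod_two_pow]
  simp

theorem two_pow_dvd_sub_iff_binDigit {k : ℕ} {x y : ℤ_[2]} :
    (2 : ℤ_[2]) ^ k ∣ x - y ↔ ∀ j < k, binDigit j x = binDigit j y := by
  rw [← toZModPow_eq_iff]
  constructor
  · intro h j hj
    rw [binDigit_eq_testBit hj, binDigit_eq_testBit hj, h]
  · intro h
    apply ZMod.val_injective
    apply Nat.eq_of_testBit_eq
    intro j
    by_cases hj : j < k
    · rw [← binDigit_eq_testBit hj, ← binDigit_eq_testBit hj, h j hj]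
    · have hk : 2 ^ k ≤ 2 ^ j := Nat.pow_le_pow_right two_pos (not_lt.mp hj)
      rw [Nat.testBit_lt_two_pow ((val_toZModPow_lt k x).trans_le hk),
        Nat.testBit_lt_two_pow ((val_toZModPow_lt k y).trans_le hk)]

theorem IsTFunction.isCompatible {f : ℤ_[2] → ℤ_[2]} (hf : IsTFunction f) : IsCompatible f := by
  obtain ⟨ψ, hψ⟩ := hf
  intro k x y h
  rw [two_pow_dvd_sub_iff_binDigit] at h ⊢
  intro j hj
  rw [hψ, hψ]
  congr 1
  funext i
  exact h i (by omega)

theorem IsCompatible.redMod_toZModPow {f : ℤ_[2] → ℤ_[2]} (hf : IsCompatible f) (k : ℕ)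
    (x : ℤ_[2]) : redMod f k (PadicInt.toZModPow k x) = PadicInt.toZModPow k (f x) := by
  rw [redMod, toZModPow_eq_iff, ← neg_sub, dvd_neg]
  exact hf k _ _ (two_pow_dvd_sub_val k x)

theorem IsCompatible.iterate_redMod {f : ℤ_[2] → ℤ_[2]} (hf : IsCompatible f) (k i : ℕ)
    (x : ℤ_[2]) :
    (redMod f k)^[i] (PadicInt.toZModPow k x) = PadicInt.toZModPow k (f^[i] x) :=
  (Function.Semiconj.iterate_right (f := PadicInt.toZModPow k) (ga := f)
    (fun y => (hf.redMod_toZModPow k y).symm) i x).symm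

/-! ### Haar measure of residue classes -/

instance : IsProbabilityMeasure haarZ2 :=
  ⟨Measure.addHaarMeasure_self (K₀ := (⊤ : TopologicalSpace.PositiveCompacts ℤ_[2]))⟩

instance : haarZ2.IsAddHaarMeasure := by unfold haarZ2; infer_instance

/-- The residue class of `a` modulo `2 ^ k`, as a subset of `ℤ_[2]`. -/
def residueClass (k : ℕ) (a : ZMod (2 ^ k)) : Set ℤ_[2] := {x | PadicInt.toZModPow k x = a}

theorem mem_residueClass {k : ℕ} {a : ZMod (2 ^ k)} {x : ℤ_[2]} :
    x ∈ residueClass k a ↔ PadicInt.toZModPow k x = a := Iff.rfl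

theorem residueClass_toZModPow (k : ℕ) (x : ℤ_[2]) :
    residueClass k (PadicInt.toZModPow k x) = Metric.closedBall x ((2 : ℝ) ^ (-(k : ℤ))) := by
  ext y
  rw [mem_residueClass, toZModPow_eq_iff, two_pow_dvd_iff_norm_le, Metric.mem_closedBall,
    dist_eq_norm]

theorem residueClass_nonempty (k : ℕ) (a : ZMod (2 ^ k)) : (residueClass k a).Nonempty :=
  ⟨_, toZModPow_val k a⟩

theorem isOpen_residueClass (k : ℕ) (a : ZMod (2 ^ k)) : IsOpen (residueClass k a) := by
  rw [← toZModPow_val k a, residueClass_toZModPow]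
  exact IsUltrametricDist.isOpen_closedBall _ (by positivity)

theorem measurableSet_residueClass (k : ℕ) (a : ZMod (2 ^ k)) : MeasurableSet (residueClass k a) :=
  (isOpen_residueClass k a).measurableSet

/-- The family of all residue classes modulo powers of two. -/
def residueClasses : Set (Set ℤ_[2]) := {s | ∃ k a, s = residueClass k a}

theorem isTopologicalBasis_residueClasses : TopologicalSpace.IsTopologicalBasis residueClasses := by
  apply TopologicalSpace.isTopologicalBasis_of_isOpen_of_nhds
  · rintro _ ⟨k, a, rfl⟩
    exact isOpen_residueClass k a
  · intro x u hx hu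
    obtain ⟨ε, hε, hεu⟩ := Metric.isOpen_iff.mp hu x hx
    obtain ⟨k, hk⟩ := PadicInt.exists_pow_neg_lt 2 hε
    refine ⟨residueClass k (PadicInt.toZModPow k x), ⟨k, _, rfl⟩, mem_residueClass.mpr rfl, ?_⟩
    rw [residueClass_toZModPow]
    exact (Metric.closedBall_subset_ball (by exact_mod_cast hk)).trans hεu

theorem isPiSystem_residueClasses : IsPiSystem residueClasses := by
  -- of two residue classes that meet, the one of higher level is contained in the other
  have key : ∀ {j k : ℕ}, j ≤ k → ∀ (a : ZMod (2 ^ j)) (b : ZMod (2 ^ k)),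
      (residueClass j a ∩ residueClass k b).Nonempty →
        residueClass j a ∩ residueClass k b = residueClass k b := by
    rintro j k hjk a b ⟨x, hxa, hxb⟩
    rw [Set.inter_eq_right]
    intro y hy
    rw [mem_residueClass] at *
    rw [← hxa, ← PadicInt.cast_toZModPow j k hjk, ← PadicInt.cast_toZModPow j k hjk, hy, hxb]
  rintro _ ⟨j, a, rfl⟩ _ ⟨k, b, rfl⟩ hne
  rcases le_total j k with h | h
  · exact ⟨k, b, key h a b hne⟩
  · rw [Set.inter_comm] at hne ⊢
    exact ⟨j, a, key h b a hne⟩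

theorem measurableSpace_eq_generateFrom_residueClasses :
    instMeasurableSpaceZ2 = MeasurableSpace.generateFrom residueClasses :=
  isTopologicalBasis_residueClasses.borel_eq_generateFrom

/-- Finite measures on `ℤ_[2]` that agree on all residue classes coincide. -/
theorem measure_ext_of_residueClass {μ ν : Measure ℤ_[2]} [IsFiniteMeasure μ]
    (h : ∀ k a, μ (residueClass k a) = ν (residueClass k a)) : μ = ν := by
  refine ext_of_generate_finite residueClasses measurableSpace_eq_generateFrom_residueClasses
    isPiSystem_residueClasses ?_ ?_
  · rintro _ ⟨k, a, rfl⟩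
    exact h k a
  · have huniv : residueClass 0 0 = Set.univ := by
      ext x
      simp [mem_residueClass, toZModPow_eq_zero_iff.mpr]
    rw [← huniv, h]

theorem sum_measure_inter_residueClass {μ : Measure ℤ_[2]} (k : ℕ) {s : Set ℤ_[2]}
    (hs : MeasurableSet s) : ∑ a : ZMod (2 ^ k), μ (s ∩ residueClass k a) = μ s := by
  rw [← measure_biUnion_finset]
  · congr 1
    ext x
    simp [mem_residueClass]
  · intro a _ b _ hab
    refine Set.disjoint_left.mpr fun x hxa hxb => hab ?_
    rw [← hxa.2, ← hxb.2]
  · exact fun a _ => hs.inter (measurableSet_residueClass k a)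

/-- By translation invariance, all residue classes of one level have the same measure. -/
theorem haarZ2_residueClass_eq (k : ℕ) (a b : ZMod (2 ^ k)) :
    haarZ2 (residueClass k a) = haarZ2 (residueClass k b) := by
  rw [← measure_preimage_add haarZ2 ((b - a).val : ℤ_[2]) (residueClass k b)]
  congr 1
  ext x
  rw [Set.mem_preimage, mem_residueClass, mem_residueClass, map_add, toZModPow_val,
    ← eq_sub_iff_add_eq', sub_sub_cancel]

theorem two_pow_mul_haarZ2_residueClass (k : ℕ) (a : ZMod (2 ^ k)) :
    2 ^ k * haarZ2 (residueClass k a) = 1 := by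
  have h := sum_measure_inter_residueClass (μ := haarZ2) k MeasurableSet.univ
  simp only [Set.univ_inter, measure_univ] at h
  rw [← h, Finset.sum_congr rfl fun b _ => haarZ2_residueClass_eq k b a]
  simp

theorem haarZ2_residueClass_ne_zero (k : ℕ) (a : ZMod (2 ^ k)) : haarZ2 (residueClass k a) ≠ 0 :=
  ((isOpen_residueClass k a).measure_pos haarZ2 (residueClass_nonempty k a)).ne'

/-! ### Ergodicity and transitivity modulo powers of two -/

theorem IsCompatible.preimage_residueClass {f : ℤ_[2] → ℤ_[2]} (hf : IsCompatible f) {k : ℕ}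
    (hg : Function.Injective (redMod f k)) (a : ZMod (2 ^ k)) :
    f ⁻¹' residueClass k (redMod f k a) = residueClass k a := by
  ext x
  rw [Set.mem_preimage, mem_residueClass, mem_residueClass, ← hf.redMod_toZModPow, hg.eq_iff]

theorem IsCompatible.measurable {f : ℤ_[2] → ℤ_[2]} (hf : IsCompatible f) : Measurable f := by
  refine Continuous.measurable (Metric.continuous_iff.mpr fun x ε hε => ?_)
  obtain ⟨k, hk⟩ := PadicInt.exists_pow_neg_lt 2 hε
  refine ⟨(2 : ℝ) ^ (-(k : ℤ)), by positivity, fun y hy => ?_⟩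
  rw [dist_eq_norm] at hy ⊢
  exact (two_pow_dvd_iff_norm_le.mp (hf k y x (two_pow_dvd_iff_norm_le.mpr hy.le))).trans_lt
    (by exact_mod_cast hk)

theorem IsCompatible.isSingleCycle_of_ergodic {f : ℤ_[2] → ℤ_[2]} (hf : IsCompatible f)
    (he : Ergodic f haarZ2) (k : ℕ) : IsSingleCycle (redMod f k) := by
  have hsurj : Function.Surjective (redMod f k) := by
    intro a
    have h : haarZ2 (f ⁻¹' residueClass k a) ≠ 0 := by
      rw [he.measure_preimage (measurableSet_residueClass k a).nullMeasurableSet]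
      exact haarZ2_residueClass_ne_zero k a
    obtain ⟨x, hx⟩ := nonempty_of_measure_ne_zero h
    exact ⟨_, (hf.redMod_toZModPow k x).trans hx⟩
  have hbij : Function.Bijective (redMod f k) := Finite.surjective_iff_bijective.mp hsurj
  refine ⟨hbij, fun a b => ?_⟩
  -- the points whose residue lies on the cycle through `a` form an invariant set
  let s : Set ℤ_[2] := ⋃ i : ℕ, residueClass k ((redMod f k)^[i] a)
  have hs : MeasurableSet s := MeasurableSet.iUnion fun i => measurableSet_residueClass _ _
  obtain ⟨n, hn, hna⟩ := (Function.mem_periodicPts (f := redMod f k) (x := a)).mp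
    (hbij.injective.mem_periodicPts a)
  have hinv : f ⁻¹' s = s := by
    simp only [s, Set.preimage_iUnion]
    apply Set.Subset.antisymm
    · refine Set.iUnion_subset fun i => ?_
      obtain ⟨j, hj⟩ : ∃ j, (redMod f k)^[i] a = redMod f k ((redMod f k)^[j] a) := by
        refine ⟨i + (n - 1), ?_⟩
        rw [← Function.iterate_succ_apply' (redMod f k), Nat.succ_eq_add_one, add_assoc,
          Nat.sub_add_cancel hn, Function.iterate_add_apply, hna]
      rw [hj, hf.preimage_residueClass hbij.injective]
      exact Set.subset_iUnion (fun i => residueClass k ((redMod f k)^[i] a)) j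
    · refine Set.iUnion_subset fun i => ?_
      rw [← hf.preimage_residueClass hbij.injective, ← Function.iterate_succ_apply' (redMod f k)]
      exact Set.subset_iUnion (fun i => f ⁻¹' residueClass k ((redMod f k)^[i] a)) (i + 1)
  rcases he.toPreErgodic.measure_self_or_compl_eq_zero hs hinv with h | h
  · exact absurd (measure_mono_null (Set.subset_iUnion _ 0) h) (haarZ2_residueClass_ne_zero k _)
  · by_contra! hb
    refine haarZ2_residueClass_ne_zero k b (measure_mono_null (fun x hx => ?_) h)
    simp only [s, Set.mem_compl_iff, Set.mem_iUnion, not_exists]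
    intro i hi
    exact hb i (hi.symm.trans hx)

theorem IsCompatible.ergodic_of_isSingleCycle {f : ℤ_[2] → ℤ_[2]} (hf : IsCompatible f)
    (hc : ∀ k, IsSingleCycle (redMod f k)) : Ergodic f haarZ2 := by
  have hmp : MeasurePreserving f haarZ2 haarZ2 := by
    refine ⟨hf.measurable, ?_⟩
    have : IsProbabilityMeasure (haarZ2.map f) :=
      Measure.isProbabilityMeasure_map hf.measurable.aemeasurable
    refine measure_ext_of_residueClass fun k a => ?_
    obtain ⟨b, rfl⟩ := (hc k).1.surjective a
    rw [Measure.map_apply hf.measurable (measurableSet_residueClass k _),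
      hf.preimage_residueClass (hc k).1.injective]
    exact haarZ2_residueClass_eq k _ _
  refine ⟨hmp, ⟨fun s hs hinv => ?_⟩⟩
  -- transitivity makes `s` equidistributed among the residue classes of each level
  have hstep (k : ℕ) (a : ZMod (2 ^ k)) :
      haarZ2 (s ∩ residueClass k (redMod f k a)) = haarZ2 (s ∩ residueClass k a) := by
    rw [← hmp.measure_preimage (hs.inter (measurableSet_residueClass k _)).nullMeasurableSet,
      Set.preimage_inter, hinv, hf.preimage_residueClass (hc k).1.injective]
  have hiter (k : ℕ) (a : ZMod (2 ^ k)) (i : ℕ) :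
      haarZ2 (s ∩ residueClass k ((redMod f k)^[i] a)) = haarZ2 (s ∩ residueClass k a) := by
    induction i with
    | zero => rfl
    | succ i ih => rw [Function.iterate_succ_apply', hstep, ih]
  have hcyl (k : ℕ) (a : ZMod (2 ^ k)) :
      haarZ2 (s ∩ residueClass k a) = haarZ2 s * haarZ2 (residueClass k a) := by
    have hall : 2 ^ k * haarZ2 (s ∩ residueClass k a) = haarZ2 s := by
      have heq (b : ZMod (2 ^ k)) :
          haarZ2 (s ∩ residueClass k b) = haarZ2 (s ∩ residueClass k a) := by
        obtain ⟨i, rfl⟩ := (hc k).2 a b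
        exact hiter k a i
      rw [← sum_measure_inter_residueClass k hs, Finset.sum_congr rfl fun b _ => heq b]
      simp
    rw [← hall, mul_right_comm, two_pow_mul_haarZ2_residueClass, one_mul]
  -- hence `s` is independent of every measurable set, in particular of itself
  have hind : haarZ2.restrict s = haarZ2 s • haarZ2 := by
    refine measure_ext_of_residueClass fun k a => ?_
    rw [Measure.restrict_apply (measurableSet_residueClass k a), Set.inter_comm, hcyl]
    rfl
  have hsq : haarZ2 s * 1 = haarZ2 s * haarZ2 s := by
    have := congrArg (fun ν : Measure ℤ_[2] => ν s) hind
    simpa using this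
  rw [Filter.eventuallyConst_set]
  by_cases h0 : haarZ2 s = 0
  · exact Or.inr (measure_eq_zero_iff_ae_notMem.mp h0)
  · have h1 : haarZ2 s = 1 :=
      ((ENNReal.mul_right_inj h0 (measure_ne_top _ _)).mp hsq).symm
    exact Or.inl ((prob_compl_eq_zero_iff hs).mpr h1)

theorem IsCompatible.ergodic_iff {f : ℤ_[2] → ℤ_[2]} (hf : IsCompatible f) :
    Ergodic f haarZ2 ↔ ∀ k, IsSingleCycle (redMod f k) :=
  ⟨fun he => hf.isSingleCycle_of_ergodic he, hf.ergodic_of_isSingleCycle⟩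

theorem isSingleCycle_redMod_zero (f : ℤ_[2] → ℤ_[2]) : IsSingleCycle (redMod f 0) := by
  have : Subsingleton (ZMod (2 ^ 0)) := inferInstanceAs (Subsingleton (ZMod 1))
  exact ⟨⟨Function.injective_of_subsingleton _, fun b => ⟨b, Subsingleton.elim _ _⟩⟩,
    fun a b => ⟨0, Subsingleton.elim _ _⟩⟩

/-! ### Lifting cycles from level `k` to level `k + 1` -/

open Function in
/-- On a finite type, a self-map is a single cycle exactly when the orbit of some (equivalently,
any) point is a cycle of full length. -/
theorem isSingleCycle_iff_minimalPeriod {α : Type*} [Fintype α] (g : α → α) (a : α) :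
    IsSingleCycle g ↔ minimalPeriod g a = Fintype.card α := by
  constructor
  · rintro ⟨hbij, htrans⟩
    refine le_antisymm minimalPeriod_le_card ?_
    have hpos : 0 < minimalPeriod g a :=
      minimalPeriod_pos_of_mem_periodicPts (hbij.injective.mem_periodicPts a)
    have hsurj : Surjective fun i : Fin (minimalPeriod g a) => g^[i] a := by
      intro b
      obtain ⟨i, rfl⟩ := htrans a b
      exact ⟨⟨i % _, Nat.mod_lt i hpos⟩, iterate_mod_minimalPeriod_eq⟩
    simpa using Fintype.card_le_of_surjective _ hsurj
  · intro h
    have hpos : 0 < minimalPeriod g a := h ▸ Fintype.card_pos_iff.mpr ⟨a⟩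
    have hinj : Injective fun i : Fin (minimalPeriod g a) => g^[i] a := fun i j hij =>
      Fin.ext (iterate_injOn_Iio_minimalPeriod i.2 j.2 hij)
    have hsurj : Surjective fun i : Fin (minimalPeriod g a) => g^[i] a :=
      ((Fintype.bijective_iff_injective_and_card _).mpr ⟨hinj, by simpa using h⟩).surjective
    have htrans : ∀ c b, ∃ i, g^[i] c = b := by
      intro c b
      obtain ⟨i, rfl⟩ := hsurj c
      obtain ⟨j, rfl⟩ := hsurj b
      refine ⟨j + (minimalPeriod g a - i), ?_⟩
      rw [← iterate_add_apply, add_assoc, Nat.sub_add_cancel i.2.le, iterate_add_minimalPeriod_eq]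
    refine ⟨Finite.surjective_iff_bijective.mp fun b => ?_, htrans⟩
    obtain ⟨i, hi⟩ := htrans (g b) b
    exact ⟨g^[i] b, by rw [← iterate_succ_apply' g, iterate_succ_apply, hi]⟩

theorem two_dvd_or_two_dvd_sub_one (c : ℤ_[2]) : (2 : ℤ_[2]) ∣ c ∨ (2 : ℤ_[2]) ∣ c - 1 := by
  have h := two_pow_dvd_sub_val 1 c
  have hlt := val_toZModPow_lt 1 c
  generalize (PadicInt.toZModPow 1 c).val = r at h hlt
  rw [pow_one] at h hlt
  interval_cases r
  · left; simpa using h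
  · right; simpa using h

theorem not_two_dvd_one : ¬ (2 : ℤ_[2]) ∣ 1 := by
  intro h
  exact PadicInt.p_nonunit (p := 2) (isUnit_of_dvd_one (by exact_mod_cast h))

theorem two_pow_ne_zero' (k : ℕ) : (2 : ℤ_[2]) ^ k ≠ 0 := pow_ne_zero k two_ne_zero

theorem two_pow_succ_dvd_mul_iff {k : ℕ} {c : ℤ_[2]} :
    (2 : ℤ_[2]) ^ (k + 1) ∣ 2 ^ k * c ↔ 2 ∣ c := by
  rw [pow_succ]
  exact mul_dvd_mul_iff_left (two_pow_ne_zero' k)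

theorem not_two_pow_succ_dvd (k : ℕ) : ¬ (2 : ℤ_[2]) ^ (k + 1) ∣ 2 ^ k := by
  rw [← mul_one ((2 : ℤ_[2]) ^ k), two_pow_succ_dvd_mul_iff]
  exact not_two_dvd_one

theorem two_pow_succ_dvd_or {k : ℕ} {x : ℤ_[2]} (h : (2 : ℤ_[2]) ^ k ∣ x) :
    (2 : ℤ_[2]) ^ (k + 1) ∣ x ∨ (2 : ℤ_[2]) ^ (k + 1) ∣ x - 2 ^ k := by
  obtain ⟨c, rfl⟩ := h
  rw [show (2 : ℤ_[2]) ^ k * c - 2 ^ k = 2 ^ k * (c - 1) by ring, two_pow_succ_dvd_mul_iff,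
    two_pow_succ_dvd_mul_iff]
  exact two_dvd_or_two_dvd_sub_one c

/-- The condition on `f` under which, for a compatible `f` that is bijective modulo `2 ^ k`, it is
also bijective modulo `2 ^ (k + 1)`: the two lifts of each residue `r` modulo `2 ^ k` have different
images. -/
def SeparatesLifts (f : ℤ_[2] → ℤ_[2]) (k : ℕ) : Prop :=
  ∀ r < 2 ^ k, (2 : ℤ_[2]) ^ (k + 1) ∣ f ((2 ^ k + r : ℕ) : ℤ_[2]) - f (r : ℤ_[2]) - 2 ^ k

/-- The sum of the increments `f r - r` over the standard representatives `r` of the residues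
modulo `2 ^ k`. -/
noncomputable def incrementSum (f : ℤ_[2] → ℤ_[2]) (k : ℕ) : ℤ_[2] :=
  ∑ r ∈ Finset.range (2 ^ k), (f (r : ℤ_[2]) - (r : ℤ_[2]))

section

variable {f : ℤ_[2] → ℤ_[2]} {k : ℕ}

theorem IsCompatible.dvd_sub_val (hf : IsCompatible f) (hs : SeparatesLifts f k) (x : ℤ_[2]) :
    (2 : ℤ_[2]) ^ (k + 1) ∣ (f x - x) -
      (f ((PadicInt.toZModPow k x).val : ℤ_[2]) - ((PadicInt.toZModPow k x).val : ℤ_[2])) := by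
  have hx := two_pow_dvd_sub_val k x
  have hr := hs _ (val_toZModPow_lt k x)
  generalize (PadicInt.toZModPow k x).val = r at hx hr
  rcases two_pow_succ_dvd_or hx with h | h
  · convert! dvd_sub (hf (k + 1) _ _ h) h using 1
    ring
  · have h' : (2 : ℤ_[2]) ^ (k + 1) ∣ x - ((2 ^ k + r : ℕ) : ℤ_[2]) := by
      convert! h using 1
      push_cast
      ring
    convert! dvd_sub (dvd_add (hf (k + 1) _ _ h') hr) h using 1
    ring

theorem IsCompatible.dvd_sub_sub (hf : IsCompatible f) (hs : SeparatesLifts f k) {x y : ℤ_[2]}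
    (h : (2 : ℤ_[2]) ^ k ∣ x - y) : (2 : ℤ_[2]) ^ (k + 1) ∣ (f x - f y) - (x - y) := by
  have hx := hf.dvd_sub_val hs x
  rw [toZModPow_eq_iff.mpr h] at hx
  convert! dvd_sub hx (hf.dvd_sub_val hs y) using 1
  ring

theorem IsCompatible.iterate (hf : IsCompatible f) (n : ℕ) : IsCompatible f^[n] := by
  induction n with
  | zero => exact fun k x y h => h
  | succ n ih =>
    intro k x y h
    rw [Function.iterate_succ_apply', Function.iterate_succ_apply']
    exact hf k _ _ (ih k x y h)

theorem IsCompatible.dvd_iterate_sub_sub (hf : IsCompatible f) (hs : SeparatesLifts f k)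
    {x y : ℤ_[2]} (h : (2 : ℤ_[2]) ^ k ∣ x - y) (n : ℕ) :
    (2 : ℤ_[2]) ^ (k + 1) ∣ (f^[n] x - f^[n] y) - (x - y) := by
  induction n with
  | zero => simp
  | succ n ih =>
    rw [Function.iterate_succ_apply', Function.iterate_succ_apply']
    convert! dvd_add (hf.dvd_sub_sub hs (hf.iterate n k x y h)) ih using 1
    ring

theorem IsCompatible.isPeriodicPt_redMod_iff (hf : IsCompatible f) {n : ℕ} :
    Function.IsPeriodicPt (redMod f k) n 0 ↔ (2 : ℤ_[2]) ^ k ∣ f^[n] 0 := by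
  rw [Function.IsPeriodicPt, Function.IsFixedPt, ← map_zero (PadicInt.toZModPow k),
    hf.iterate_redMod, map_zero, toZModPow_eq_zero_iff]

theorem isSingleCycle_redMod_iff :
    IsSingleCycle (redMod f k) ↔ Function.minimalPeriod (redMod f k) 0 = 2 ^ k := by
  rw [isSingleCycle_iff_minimalPeriod _ 0, ZMod.card]

/-- Telescoping along the orbit of `0`: if `f` is transitive modulo `2 ^ k`, the first `2 ^ k`
points of the orbit visit every residue once, so the total increment is `incrementSum f k`. -/
theorem IsCompatible.dvd_iterate_sub_incrementSum (hf : IsCompatible f) (hs : SeparatesLifts f k)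
    (hc : IsSingleCycle (redMod f k)) :
    (2 : ℤ_[2]) ^ (k + 1) ∣ f^[2 ^ k] 0 - incrementSum f k := by
  let ρ : ℕ → ℕ := fun i => (PadicInt.toZModPow k (f^[i] 0)).val
  have htel (n : ℕ) : (2 : ℤ_[2]) ^ (k + 1) ∣
      f^[n] 0 - ∑ i ∈ Finset.range n, (f (ρ i : ℤ_[2]) - (ρ i : ℤ_[2])) := by
    induction n with
    | zero => simp
    | succ n ih =>
      rw [Finset.sum_range_succ, Function.iterate_succ_apply']
      convert! dvd_add ih (hf.dvd_sub_val hs (f^[n] 0)) using 1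
      ring
  have hinj : Set.InjOn ρ (Finset.range (2 ^ k)) := by
    intro i hi j hj hij
    have hij' := ZMod.val_injective _ hij
    rw [← hf.iterate_redMod, ← hf.iterate_redMod, map_zero] at hij'
    rw [isSingleCycle_redMod_iff] at hc
    refine Function.iterate_injOn_Iio_minimalPeriod (f := redMod f k) (x := 0) ?_ ?_ hij'
    · simpa [hc] using hi
    · simpa [hc] using hj
  have himg : (Finset.range (2 ^ k)).image ρ = Finset.range (2 ^ k) := by
    refine Finset.eq_of_subset_of_card_le ?_ (Finset.card_image_of_injOn hinj).ge
    intro r hr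
    obtain ⟨i, -, rfl⟩ := Finset.mem_image.mp hr
    exact Finset.mem_range.mpr (val_toZModPow_lt k _)
  have hsum := htel (2 ^ k)
  rwa [← Finset.sum_image (f := fun r : ℕ => f (r : ℤ_[2]) - (r : ℤ_[2])) hinj, himg] at hsum

theorem IsCompatible.separatesLifts_of_injective (hf : IsCompatible f)
    (hg : Function.Injective (redMod f (k + 1))) : SeparatesLifts f k := by
  intro r hr
  have h : (2 : ℤ_[2]) ^ k ∣ f ((2 ^ k + r : ℕ) : ℤ_[2]) - f (r : ℤ_[2]) :=
    hf k _ _ (by push_cast; simp)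
  refine (two_pow_succ_dvd_or h).resolve_left fun h' => not_two_pow_succ_dvd k ?_
  rw [← toZModPow_eq_iff, ← hf.redMod_toZModPow, ← hf.redMod_toZModPow, hg.eq_iff,
    toZModPow_eq_iff] at h'
  simpa using h'

/-- A map that is transitive modulo `2 ^ k` is transitive modulo `2 ^ (k + 1)` if and only if lifts
are separated and the `2 ^ k`-th iterate moves `0` to the other lift of `0`. -/
theorem IsCompatible.isSingleCycle_succ_iff (hf : IsCompatible f)
    (hc : IsSingleCycle (redMod f k)) :
    IsSingleCycle (redMod f (k + 1)) ↔
      SeparatesLifts f k ∧ (2 : ℤ_[2]) ^ (k + 1) ∣ incrementSum f k - 2 ^ k := by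
  have hk : (2 : ℤ_[2]) ^ k ∣ f^[2 ^ k] 0 := by
    rw [← hf.isPeriodicPt_redMod_iff, Function.isPeriodicPt_iff_minimalPeriod_dvd]
    exact (isSingleCycle_redMod_iff.mp hc).dvd
  constructor
  · intro hc'
    have hs := hf.separatesLifts_of_injective hc'.1.injective
    refine ⟨hs, ?_⟩
    have hne : ¬ (2 : ℤ_[2]) ^ (k + 1) ∣ f^[2 ^ k] 0 := by
      rw [← hf.isPeriodicPt_redMod_iff, Function.isPeriodicPt_iff_minimalPeriod_dvd,
        isSingleCycle_redMod_iff.mp hc', Nat.pow_dvd_pow_iff_le_right']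
      omega
    convert! dvd_sub ((two_pow_succ_dvd_or hk).resolve_left hne)
      (hf.dvd_iterate_sub_incrementSum hs hc) using 1
    ring
  · rintro ⟨hs, hsum⟩
    have hmove : (2 : ℤ_[2]) ^ (k + 1) ∣ f^[2 ^ k] 0 - 2 ^ k := by
      convert! dvd_add (hf.dvd_iterate_sub_incrementSum hs hc) hsum using 1
      ring
    have hne : ¬ (2 : ℤ_[2]) ^ (k + 1) ∣ f^[2 ^ k] 0 := fun h =>
      not_two_pow_succ_dvd k ((dvd_sub_right h).mp hmove)
    have hper : (2 : ℤ_[2]) ^ (k + 1) ∣ f^[2 ^ (k + 1)] 0 := by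
      -- the second run of `2 ^ k` steps repeats the increment of the first one
      have h := hf.dvd_iterate_sub_sub hs (x := f^[2 ^ k] 0) (y := 0) (by simpa using hk) (2 ^ k)
      rw [← Function.iterate_add_apply, ← two_mul, ← pow_succ'] at h
      have h2 : (2 : ℤ_[2]) ^ (k + 1) ∣ 2 * f^[2 ^ k] 0 := by
        rw [pow_succ']
        exact mul_dvd_mul_left 2 hk
      convert! dvd_add h h2 using 1
      ring
    rw [← hf.isPeriodicPt_redMod_iff, Function.isPeriodicPt_iff_minimalPeriod_dvd] at hne hper
    obtain ⟨j, hj, hjeq⟩ := (Nat.dvd_prime_pow Nat.prime_two).mp hper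
    rw [isSingleCycle_redMod_iff, hjeq]
    rw [hjeq, Nat.pow_dvd_pow_iff_le_right'] at hne
    congr 1
    omega

theorem IsCompatible.forall_isSingleCycle_iff (hf : IsCompatible f) :
    (∀ k, IsSingleCycle (redMod f k)) ↔
      ∀ k, SeparatesLifts f k ∧ (2 : ℤ_[2]) ^ (k + 1) ∣ incrementSum f k - 2 ^ k := by
  constructor
  · exact fun h k => (hf.isSingleCycle_succ_iff (h k)).mp (h (k + 1))
  · intro h k
    induction k with
    | zero => exact isSingleCycle_redMod_zero f
    | succ k ih => exact (hf.isSingleCycle_succ_iff ih).mpr (h k)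

end

/-! ### The van der Put expansion -/

theorem vdpChi_eq_ite (m : ℕ) (x : ℤ_[2]) [Decidable ((2 : ℤ_[2]) ^ (Nat.log 2 m + 1) ∣ x - m)] :
    vdpChi m x = if (2 : ℤ_[2]) ^ (Nat.log 2 m + 1) ∣ x - m then 1 else 0 := by
  unfold vdpChi
  simp only [two_pow_dvd_iff_norm_le]

theorem vdpChi_of_dvd {m : ℕ} {x : ℤ_[2]} (h : (2 : ℤ_[2]) ^ (Nat.log 2 m + 1) ∣ x - m) :
    vdpChi m x = 1 := by
  classical rw [vdpChi_eq_ite, if_pos h]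

theorem vdpChi_of_not_dvd {m : ℕ} {x : ℤ_[2]} (h : ¬ (2 : ℤ_[2]) ^ (Nat.log 2 m + 1) ∣ x - m) :
    vdpChi m x = 0 := by
  classical rw [vdpChi_eq_ite, if_neg h]

theorem vdpChi_congr {m : ℕ} {x y : ℤ_[2]} (h : (2 : ℤ_[2]) ^ (Nat.log 2 m + 1) ∣ x - y) :
    vdpChi m x = vdpChi m y := by
  classical
  rw [vdpChi_eq_ite, vdpChi_eq_ite, ← sub_add_sub_cancel x y (m : ℤ_[2]), dvd_add_right h]

theorem log_two_pow_add {k r : ℕ} (hr : r < 2 ^ k) : Nat.log 2 (2 ^ k + r) = k :=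
  Nat.log_eq_of_pow_le_of_lt_pow (Nat.le_add_right _ _) (by rw [pow_succ]; omega)

theorem lt_two_pow_log_succ (m : ℕ) : m < 2 ^ (Nat.log 2 m + 1) :=
  Nat.lt_pow_succ_log_self one_lt_two m

/-- The sum of the terms of a van der Put series with coefficients `B` whose indices have at most
`n` binary digits. -/
noncomputable def vdpPartialSum (B : ℕ → ℤ_[2]) (n : ℕ) (x : ℤ_[2]) : ℤ_[2] :=
  ∑ m ∈ Finset.range (2 ^ n), B m * vdpChi m x

theorem vdpPartialSum_one (B : ℕ → ℤ_[2]) (x : ℤ_[2]) :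
    vdpPartialSum B 1 x = B 0 * vdpChi 0 x + B 1 * vdpChi 1 x := by
  simp [vdpPartialSum, Finset.sum_range_succ]

theorem vdpPartialSum_succ (B : ℕ → ℤ_[2]) (n : ℕ) (x : ℤ_[2]) :
    vdpPartialSum B (n + 1) x = vdpPartialSum B n x +
      ∑ r ∈ Finset.range (2 ^ n), B (2 ^ n + r) * vdpChi (2 ^ n + r) x := by
  rw [vdpPartialSum, pow_succ, mul_two, Finset.sum_range_add, vdpPartialSum]

/-- If `x` is congruent modulo `2 ^ (n + 1)` to a natural number of at most `n` digits, the terms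
with `(n + 1)`-digit indices vanish at `x`. -/
theorem vdpPartialSum_succ_of_lt (B : ℕ → ℤ_[2]) {n r : ℕ} (hr : r < 2 ^ n) {x : ℤ_[2]}
    (hx : (2 : ℤ_[2]) ^ (n + 1) ∣ x - r) :
    vdpPartialSum B (n + 1) x = vdpPartialSum B n x := by
  rw [vdpPartialSum_succ, Finset.sum_eq_zero, add_zero]
  intro s hs
  rw [Finset.mem_range] at hs
  rw [vdpChi_of_not_dvd, mul_zero]
  rw [log_two_pow_add hs]
  intro h
  have heq : r = 2 ^ n + s := by
    refine eq_of_lt_of_two_pow_dvd (k := n + 1) (by rw [pow_succ]; omega)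
      (by rw [pow_succ]; omega) ?_
    convert! dvd_sub h hx using 1
    ring
  omega

/-- If `x` is congruent modulo `2 ^ (n + 1)` to the `(n + 1)`-digit number `2 ^ n + r`, the term
with that index is the only one with an `(n + 1)`-digit index that survives at `x`. -/
theorem vdpPartialSum_succ_of_dvd (B : ℕ → ℤ_[2]) {n r : ℕ} (hr : r < 2 ^ n) {x : ℤ_[2]}
    (hx : (2 : ℤ_[2]) ^ (n + 1) ∣ x - ((2 ^ n + r : ℕ) : ℤ_[2])) :
    vdpPartialSum B (n + 1) x = vdpPartialSum B n x + B (2 ^ n + r) := by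
  rw [vdpPartialSum_succ, Finset.sum_eq_single r]
  · rw [vdpChi_of_dvd, mul_one]
    rwa [log_two_pow_add hr]
  · intro s hs hsr
    rw [Finset.mem_range] at hs
    rw [vdpChi_of_not_dvd, mul_zero]
    rw [log_two_pow_add hs]
    intro h
    have heq : 2 ^ n + r = 2 ^ n + s := by
      refine eq_of_lt_of_two_pow_dvd (k := n + 1) (by rw [pow_succ]; omega)
        (by rw [pow_succ]; omega) ?_
      convert! dvd_sub h hx using 1
      ring
    omega
  · intro h
    exact absurd (Finset.mem_range.mpr hr) h

theorem vdpPartialSum_congr (B : ℕ → ℤ_[2]) {n : ℕ} (hn : 1 ≤ n) {x y : ℤ_[2]}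
    (h : (2 : ℤ_[2]) ^ n ∣ x - y) : vdpPartialSum B n x = vdpPartialSum B n y := by
  refine Finset.sum_congr rfl fun m hm => ?_
  rw [vdpChi_congr ((pow_dvd_pow 2 ?_).trans h)]
  rcases Nat.eq_zero_or_pos m with rfl | hm0
  · simpa using hn
  · exact Nat.log_lt_of_lt_pow hm0.ne' (Finset.mem_range.mp hm)

/-- At a natural number `r < 2 ^ n` the van der Put series is a finite sum. -/
theorem hasSum_vdpPartialSum (B : ℕ → ℤ_[2]) {n r : ℕ} (hr : r < 2 ^ n) :
    HasSum (fun m => B m * vdpChi m (r : ℤ_[2])) (vdpPartialSum B n r) := by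
  refine hasSum_sum_of_ne_finset_zero fun m hm => ?_
  rw [Finset.mem_range, not_lt] at hm
  rw [vdpChi_of_not_dvd, mul_zero]
  intro h
  have heq := eq_of_lt_of_two_pow_dvd ((hr.trans_le hm).trans (lt_two_pow_log_succ m))
    (lt_two_pow_log_succ m) h
  omega

/-- The sequence `b` consists of the normalized van der Put coefficients of `f`: for an index
`m = 2 ^ k + r` with `r < 2 ^ k`, so that `r` is `m` without its leading binary digit, the
coefficient of `χ(m, ·)` is `2 ^ k * b m = f m - f r`. -/
def IsVdpCoeff (f : ℤ_[2] → ℤ_[2]) (b : ℕ → ℤ_[2]) : Prop :=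
  b 0 = f 0 ∧ b 1 = f 1 ∧ ∀ k, 1 ≤ k → ∀ r < 2 ^ k,
    2 ^ k * b (2 ^ k + r) = f ((2 ^ k + r : ℕ) : ℤ_[2]) - f (r : ℤ_[2])

theorem vdpChi_zero_zero : vdpChi 0 0 = 1 := vdpChi_of_dvd (by simp)

theorem vdpChi_one_one : vdpChi 1 1 = 1 := vdpChi_of_dvd (by simp)

theorem vdpChi_zero_of_odd {x : ℤ_[2]} (h : (2 : ℤ_[2]) ∣ x - 1) : vdpChi 0 x = 0 := by
  refine vdpChi_of_not_dvd fun h' => not_two_dvd_one ?_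
  simpa only [sub_sub_cancel] using dvd_sub (show (2 : ℤ_[2]) ∣ x by simpa using h') h

theorem vdpChi_one_of_even {x : ℤ_[2]} (h : (2 : ℤ_[2]) ∣ x) : vdpChi 1 x = 0 := by
  refine vdpChi_of_not_dvd fun h' => not_two_dvd_one ?_
  simpa only [sub_sub_cancel] using dvd_sub h (show (2 : ℤ_[2]) ∣ x - 1 by simpa using h')

theorem IsVdpCoeff.vdpPartialSum_eq {f : ℤ_[2] → ℤ_[2]} {b : ℕ → ℤ_[2]} (hb : IsVdpCoeff f b)
    {n : ℕ} (hn : 1 ≤ n) {r : ℕ} (hr : r < 2 ^ n) {x : ℤ_[2]} (hx : (2 : ℤ_[2]) ^ n ∣ x - r) :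
    vdpPartialSum (fun m => 2 ^ Nat.log 2 m * b m) n x = f r := by
  induction n, hn using Nat.le_induction generalizing r with
  | base =>
    rw [vdpPartialSum_one]
    rw [pow_one] at hr hx
    interval_cases r
    · rw [Nat.cast_zero, sub_zero] at hx
      rw [vdpChi_one_of_even hx, vdpChi_of_dvd (by simpa using hx)]
      simp [hb.1]
    · rw [Nat.cast_one] at hx
      rw [vdpChi_zero_of_odd hx, vdpChi_of_dvd (by simpa using hx)]
      simp [hb.2.1]
  | succ n hn ih =>
    have hx' : (2 : ℤ_[2]) ^ n ∣ x - r := (pow_dvd_pow 2 n.le_succ).trans hx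
    rcases lt_or_ge r (2 ^ n) with h | h
    · rw [vdpPartialSum_succ_of_lt _ h hx, ih h hx']
    · obtain ⟨s, rfl⟩ := Nat.exists_eq_add_of_le h
      have hs : s < 2 ^ n := by rw [pow_succ] at hr; omega
      have hxs : (2 : ℤ_[2]) ^ n ∣ x - s := by
        convert! dvd_add hx' (dvd_refl ((2 : ℤ_[2]) ^ n)) using 1
        push_cast
        ring
      rw [vdpPartialSum_succ_of_dvd _ hs hx, ih hs hxs, log_two_pow_add hs, hb.2.2 n hn s hs]
      ring

theorem summable_vdp (b : ℕ → ℤ_[2]) (x : ℤ_[2]) :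
    Summable fun m => 2 ^ Nat.log 2 m * b m * vdpChi m x := by
  refine NonarchimedeanAddGroup.summable_of_tendsto_cofinite_zero ?_
  rw [Nat.cofinite_eq_atTop]
  have hlog : Filter.Tendsto (Nat.log 2) Filter.atTop Filter.atTop :=
    Filter.tendsto_atTop.mpr fun n => (Filter.eventually_ge_atTop (2 ^ n)).mono fun m hm =>
      Nat.le_log_of_pow_le one_lt_two hm
  refine squeeze_zero_norm (a := fun m => (2⁻¹ : ℝ) ^ Nat.log 2 m) (fun m => ?_)
    ((tendsto_pow_atTop_nhds_zero_of_lt_one (by norm_num) (by norm_num)).comp hlog)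
  have h := two_pow_dvd_iff_norm_le.mp
    (show (2 : ℤ_[2]) ^ Nat.log 2 m ∣ 2 ^ Nat.log 2 m * b m * vdpChi m x from
      (dvd_mul_right _ _).mul_right _)
  simpa using h

theorem IsVdpCoeff.hasSum {f : ℤ_[2] → ℤ_[2]} (hf : IsCompatible f) {b : ℕ → ℤ_[2]}
    (hb : IsVdpCoeff f b) (x : ℤ_[2]) :
    HasSum (fun m => 2 ^ Nat.log 2 m * b m * vdpChi m x) (f x) := by
  have hsum := (summable_vdp b x).hasSum
  have hlim := hsum.tendsto_sum_nat.comp (tendsto_pow_atTop_atTop_of_one_lt one_lt_two)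
  have hlim' : Filter.Tendsto
      (fun n => vdpPartialSum (fun m => 2 ^ Nat.log 2 m * b m) n x) Filter.atTop (nhds (f x)) := by
    rw [tendsto_iff_norm_sub_tendsto_zero]
    refine squeeze_zero' (g := fun n : ℕ => (2⁻¹ : ℝ) ^ n)
      (Filter.Eventually.of_forall fun n => norm_nonneg _)
      ((Filter.eventually_ge_atTop 1).mono fun n hn => ?_)
      (tendsto_pow_atTop_nhds_zero_of_lt_one (by norm_num) (by norm_num))
    rw [hb.vdpPartialSum_eq hn (val_toZModPow_lt n x) (two_pow_dvd_sub_val n x), norm_sub_rev]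
    simpa using two_pow_dvd_iff_norm_le.mp (hf n _ _ (two_pow_dvd_sub_val n x))
  rwa [tendsto_nhds_unique hlim' hlim]

theorem isVdpCoeff_of_hasSum {f : ℤ_[2] → ℤ_[2]} {b : ℕ → ℤ_[2]}
    (h : ∀ x, HasSum (fun m => 2 ^ Nat.log 2 m * b m * vdpChi m x) (f x)) : IsVdpCoeff f b := by
  have heval {n r : ℕ} (hr : r < 2 ^ n) :
      f r = vdpPartialSum (fun m => 2 ^ Nat.log 2 m * b m) n r :=
    (h r).unique (hasSum_vdpPartialSum _ hr)
  refine ⟨?_, ?_, fun k hk r hr => ?_⟩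
  · have h0 := heval (n := 1) (r := 0) (by norm_num)
    rw [vdpPartialSum_one, Nat.cast_zero, vdpChi_zero_zero, vdpChi_one_of_even (dvd_zero _)] at h0
    simpa using h0.symm
  · have h1 := heval (n := 1) (r := 1) (by norm_num)
    rw [vdpPartialSum_one, Nat.cast_one, vdpChi_one_one, vdpChi_zero_of_odd (by simp)] at h1
    simpa using h1.symm
  · rw [heval hr, heval (n := k + 1) (r := 2 ^ k + r) (by rw [pow_succ]; omega),
      vdpPartialSum_succ_of_dvd _ hr (by simp),
      vdpPartialSum_congr _ hk (x := ((2 ^ k + r : ℕ) : ℤ_[2])) (y := r) (by push_cast; simp),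
      log_two_pow_add hr]
    ring

theorem IsCompatible.exists_isVdpCoeff {f : ℤ_[2] → ℤ_[2]} (hf : IsCompatible f) :
    ∃ b, IsVdpCoeff f b := by
  have hdvd (m : ℕ) (hm : 2 ≤ m) : (2 : ℤ_[2]) ^ Nat.log 2 m ∣
      f m - f ((m - 2 ^ Nat.log 2 m : ℕ) : ℤ_[2]) := by
    refine hf _ _ _ ?_
    rw [Nat.cast_sub (Nat.pow_log_le_self 2 (by omega))]
    simp
  choose! c hc using hdvd
  refine ⟨fun m => if m < 2 then f m else c m, by simp, by simp, fun k hk r hr => ?_⟩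
  have h2 : 2 ≤ 2 ^ k + r := by
    have : 2 ^ 1 ≤ 2 ^ k := Nat.pow_le_pow_right two_pos hk
    omega
  have h := hc (2 ^ k + r) h2
  rw [log_two_pow_add hr, Nat.add_sub_cancel_left] at h
  beta_reduce
  rw [if_neg (by omega), ← h]

/-- Splitting off the first two terms, whose normalizing factor `2 ^ ⌊log₂ m⌋` is `1`. -/
theorem summable_and_eq_iff_hasSum (b : ℕ → ℤ_[2]) (x y : ℤ_[2]) :
    (Summable (fun m : ℕ => 2 ^ Nat.log 2 (m + 2) * b (m + 2) * vdpChi (m + 2) x) ∧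
      y = b 0 * vdpChi 0 x + b 1 * vdpChi 1 x +
        ∑' m : ℕ, 2 ^ Nat.log 2 (m + 2) * b (m + 2) * vdpChi (m + 2) x) ↔
      HasSum (fun m => 2 ^ Nat.log 2 m * b m * vdpChi m x) y := by
  rw [← hasSum_nat_add_iff' 2]
  simp only [Finset.sum_range_succ, Finset.sum_range_zero, Nat.log_zero_right, Nat.log_one_right,
    pow_zero, one_mul, zero_add]
  constructor
  · rintro ⟨hs, hy⟩
    rw [hy, add_sub_cancel_left]
    exact hs.hasSum
  · intro h
    exact ⟨h.summable, by rw [h.tsum_eq]; ring⟩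

/-! ### Transitivity in terms of van der Put coefficients -/

theorem norm_eq_one_iff_two_dvd_sub_one {c : ℤ_[2]} : ‖c‖ = 1 ↔ (2 : ℤ_[2]) ∣ c - 1 := by
  have h : ‖c‖ < 1 ↔ (2 : ℤ_[2]) ∣ c := by exact_mod_cast PadicInt.norm_lt_one_iff_dvd (p := 2) c
  constructor
  · intro h1
    exact (two_dvd_or_two_dvd_sub_one c).resolve_left fun h2 => (h.mpr h2).ne h1
  · intro h1
    refine le_antisymm (PadicInt.norm_le_one c) (not_lt.mp fun h2 => not_two_dvd_one ?_)
    simpa only [sub_sub_cancel] using dvd_sub (h.mp h2) h1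

section

variable {f : ℤ_[2] → ℤ_[2]} {b : ℕ → ℤ_[2]}

theorem separatesLifts_zero_iff : SeparatesLifts f 0 ↔ (2 : ℤ_[2]) ∣ f 1 - f 0 - 1 := by
  simp [SeparatesLifts]

theorem IsVdpCoeff.separatesLifts_iff (hb : IsVdpCoeff f b) {k : ℕ} (hk : 1 ≤ k) :
    SeparatesLifts f k ↔ ∀ r < 2 ^ k, ‖b (2 ^ k + r)‖ = 1 := by
  refine forall₂_congr fun r hr => ?_
  rw [← hb.2.2 k hk r hr, norm_eq_one_iff_two_dvd_sub_one, ← two_pow_succ_dvd_mul_iff (k := k),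
    mul_sub, mul_one]

theorem IsVdpCoeff.incrementSum_succ (hb : IsVdpCoeff f b) {k : ℕ} (hk : 1 ≤ k) :
    incrementSum f (k + 1) - 2 ^ (k + 1) = 2 * (incrementSum f k - 2 ^ k) +
      2 ^ k * ((∑ r ∈ Finset.range (2 ^ k), b (2 ^ k + r)) - 2 ^ k) := by
  have h : ∑ r ∈ Finset.range (2 ^ k),
      (f ((2 ^ k + r : ℕ) : ℤ_[2]) - ((2 ^ k + r : ℕ) : ℤ_[2])) =
      incrementSum f k + 2 ^ k * (∑ r ∈ Finset.range (2 ^ k), b (2 ^ k + r)) - 2 ^ k * 2 ^ k := by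
    have hcard : (2 : ℤ_[2]) ^ k * 2 ^ k = ∑ r ∈ Finset.range (2 ^ k), 2 ^ k := by simp
    rw [hcard, incrementSum, Finset.mul_sum, ← Finset.sum_add_distrib, ← Finset.sum_sub_distrib]
    refine Finset.sum_congr rfl fun r hr => ?_
    rw [hb.2.2 k hk r (Finset.mem_range.mp hr)]
    push_cast
    ring
  rw [incrementSum, pow_succ 2 k, mul_two, Finset.sum_range_add, h, ← incrementSum]
  ring

theorem IsVdpCoeff.dvd_incrementSum_succ_iff (hb : IsVdpCoeff f b) {k : ℕ} (hk : 1 ≤ k)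
    (h : (2 : ℤ_[2]) ^ (k + 1) ∣ incrementSum f k - 2 ^ k) :
    (2 : ℤ_[2]) ^ (k + 1 + 1) ∣ incrementSum f (k + 1) - 2 ^ (k + 1) ↔
      (4 : ℤ_[2]) ∣ (∑ r ∈ Finset.range (2 ^ k), b (2 ^ k + r)) - 2 ^ k := by
  have h2 : (2 : ℤ_[2]) ^ (k + 1 + 1) ∣ 2 * (incrementSum f k - 2 ^ k) := by
    rw [pow_succ']
    exact mul_dvd_mul_left 2 h
  rw [hb.incrementSum_succ hk, dvd_add_right h2,
    show (2 : ℤ_[2]) ^ (k + 1 + 1) = 2 ^ k * 4 by ring]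
  exact mul_dvd_mul_iff_left (two_pow_ne_zero' k)

theorem sum_Icc_two_pow (b : ℕ → ℤ_[2]) (k : ℕ) :
    ∑ m ∈ Finset.Icc (2 ^ k) (2 ^ (k + 1) - 1), b m =
      ∑ r ∈ Finset.range (2 ^ k), b (2 ^ k + r) := by
  have hIcc : Finset.Icc (2 ^ k) (2 ^ (k + 1) - 1) = Finset.Ico (2 ^ k) (2 ^ (k + 1)) := by
    ext m
    have := Nat.two_pow_pos (k + 1)
    simp only [Finset.mem_Icc, Finset.mem_Ico]
    omega
  rw [hIcc, Finset.sum_Ico_eq_sum_range]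
  congr 2
  rw [pow_succ]
  omega

theorem four_dvd_two_pow {k : ℕ} (hk : 2 ≤ k) : (4 : ℤ_[2]) ∣ 2 ^ k := by
  have h : (2 : ℤ_[2]) ^ 2 ∣ 2 ^ k := pow_dvd_pow 2 hk
  norm_num at h
  exact h

/-- The criterion for transitivity modulo all powers of two, level by level, expressed in the van
der Put coefficients. -/
theorem IsVdpCoeff.forall_separatesLifts_and_dvd_iff (hb : IsVdpCoeff f b) :
    (∀ k, SeparatesLifts f k ∧ (2 : ℤ_[2]) ^ (k + 1) ∣ incrementSum f k - 2 ^ k) ↔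
      (2 : ℤ_[2]) ∣ b 0 - 1 ∧ (4 : ℤ_[2]) ∣ b 0 + b 1 - 3 ∧ (∀ m : ℕ, 2 ≤ m → ‖b m‖ = 1) ∧
      (4 : ℤ_[2]) ∣ b 2 + b 3 - 2 ∧
      ∀ n : ℕ, 3 ≤ n → (4 : ℤ_[2]) ∣ ∑ m ∈ Finset.Icc (2 ^ (n - 1)) (2 ^ n - 1), b m := by
  have hlevel0 : incrementSum f 0 - 2 ^ 0 = b 0 - 1 := by simp [incrementSum, hb.1]
  have hlevel1 : incrementSum f 1 - 2 ^ 1 = b 0 + b 1 - 3 := by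
    simp only [incrementSum, pow_one, Finset.sum_range_succ, Finset.sum_range_zero, Nat.cast_zero,
      Nat.cast_one, hb.1, hb.2.1]
    ring
  have hdigit2 : (∑ r ∈ Finset.range (2 ^ 1), b (2 ^ 1 + r)) - 2 ^ 1 = b 2 + b 3 - 2 := by
    simp [Finset.sum_range_succ]
  have hfour : (2 : ℤ_[2]) ^ (1 + 1) = 4 := by norm_num
  constructor
  · intro h
    refine ⟨?_, ?_, fun m hm => ?_, ?_, fun n hn => ?_⟩
    · simpa only [hlevel0, zero_add, pow_one] using (h 0).2
    · simpa only [hlevel1, hfour] using (h 1).2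
    · have hlog : 1 ≤ Nat.log 2 m := Nat.le_log_of_pow_le one_lt_two (by simpa using hm)
      obtain ⟨r, hr⟩ := Nat.exists_eq_add_of_le (Nat.pow_log_le_self 2 (x := m) (by omega))
      have hlt := lt_two_pow_log_succ m
      rw [pow_succ] at hlt
      rw [hr]
      exact (hb.separatesLifts_iff hlog).mp (h _).1 r (by omega)
    · rw [← hdigit2]
      exact (hb.dvd_incrementSum_succ_iff le_rfl (h 1).2).mp (h 2).2
    · obtain ⟨k, rfl⟩ := Nat.exists_eq_add_of_le' (show 1 ≤ n by omega)
      rw [Nat.add_sub_cancel, sum_Icc_two_pow]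
      have hk := (hb.dvd_incrementSum_succ_iff (by omega) (h k).2).mp (h (k + 1)).2
      exact (dvd_sub_left (four_dvd_two_pow (by omega))).mp hk
  · rintro ⟨h1, h2, h3, h4, h5⟩ k
    constructor
    · rcases Nat.eq_zero_or_pos k with rfl | hk
      · rw [separatesLifts_zero_iff, ← hb.1, ← hb.2.1]
        obtain ⟨c, hc⟩ := h2
        exact ⟨2 * c + 1 - b 0, by linear_combination hc⟩
      · rw [hb.separatesLifts_iff hk]
        intro r _
        have : 2 ^ 1 ≤ 2 ^ k := Nat.pow_le_pow_right two_pos hk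
        exact h3 _ (by omega)
    · rcases Nat.eq_zero_or_pos k with rfl | hk
      · rw [hlevel0]
        simpa using h1
      · induction k, hk using Nat.le_induction with
        | base => rwa [hlevel1, hfour]
        | succ k hk ih =>
          rw [hb.dvd_incrementSum_succ_iff hk ih]
          rcases Nat.lt_or_ge k 2 with hk2 | hk2
          · obtain rfl : k = 1 := by omega
            rwa [hdigit2]
          · have h := h5 (k + 1) (by omega)
            rw [Nat.add_sub_cancel, sum_Icc_two_pow] at h
            exact dvd_sub h (four_dvd_two_pow hk2)

end

theorem theorem3p5 (f : ℤ_[2] → ℤ_[2]) (hf : IsTFunction f) :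
    (Ergodic f haarZ2 ↔ ∀ k : ℕ, 1 ≤ k → IsSingleCycle (redMod f k)) ∧
    (Ergodic f haarZ2 ↔
      ∃ b : ℕ → ℤ_[2],
        (∀ x : ℤ_[2],
          Summable (fun m : ℕ => 2 ^ Nat.log 2 (m + 2) * b (m + 2) * vdpChi (m + 2) x) ∧
          f x = b 0 * vdpChi 0 x + b 1 * vdpChi 1 x +
            ∑' m : ℕ, 2 ^ Nat.log 2 (m + 2) * b (m + 2) * vdpChi (m + 2) x) ∧
        (2 : ℤ_[2]) ∣ b 0 - 1 ∧
        (4 : ℤ_[2]) ∣ b 0 + b 1 - 3 ∧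
        (∀ m : ℕ, 2 ≤ m → ‖b m‖ = 1) ∧
        (4 : ℤ_[2]) ∣ b 2 + b 3 - 2 ∧
        (∀ n : ℕ, 3 ≤ n → (4 : ℤ_[2]) ∣ ∑ m ∈ Finset.Icc (2 ^ (n - 1)) (2 ^ n - 1), b m)) := by
  have hc := hf.isCompatible
  refine ⟨hc.ergodic_iff.trans ⟨fun h k _ => h k, fun h k => ?_⟩, ?_⟩
  · rcases Nat.eq_zero_or_pos k with rfl | hk
    · exact isSingleCycle_redMod_zero f
    · exact h k hk
  · rw [hc.ergodic_iff, hc.forall_isSingleCycle_iff]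
    simp only [summable_and_eq_iff_hasSum]
    constructor
    · intro h
      obtain ⟨b, hb⟩ := hc.exists_isVdpCoeff
      exact ⟨b, hb.hasSum hc, hb.forall_separatesLifts_and_dvd_iff.mp h⟩
    · rintro ⟨b, hsum, hb⟩
      exact (isVdpCoeff_of_hasSum hsum).forall_separatesLifts_and_dvd_iff.mpr hb
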